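/- Let $n\ge 2$ and let $k$ be a field of characteristic $2$ which is a splitting field for the alternating group $\mathcal A_n$, i.e. $\operatorname{End}_{k\mathcal A_n}(M)=k$ for every irreducible $k\mathcal A_n$-module $M$. Call a $k\mathcal A_n$-module $M$ self-dual if it is isomorphic to its dual $M^*=\operatorname{Hom}_k(M,k)$, and call a partition strict if its parts are pairwise distinct. Then the number of isomorphism classes of self-dual irreducible $k\mathcal A_n$-modules equals the number of non-strict partitions of $n$ all of whose parts are odd, plus twice the number of strict partitions $\mu$ of $n$ all of whose parts are odd and for which $\frac{n-\ell(\mu)}{2}$ is even, where $\ell(\mu)$ denotes the number of parts of $\mu$. -/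

import Mathlib

universe u

/-- `k` is a splitting field for the group `G`: the only endomorphisms of an irreducible
`kG`-module are the scalars. (`G` lives in `Type`, and every irreducible `kG`-module is a quotient
of `kG`, so all of them occur, up to isomorphism, on vector spaces in the universe of `k`.) -/
def IsSplittingFieldFor (k : Type u) (G : Type) [Field k] [Group G] : Prop :=
  ∀ (V : Type u) [AddCommGroup V] [Module k V] (ρ : Representation k G V),
    ρ.IsIrreducible →
      ∀ f : Representation.IntertwiningMap ρ ρ, ∃ c : k, ∀ v : V, f v = c • v

/-- A `kG`-module is self-dual if it is isomorphic to its contragredient `Hom_k(M, k)`. -/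
def IsSelfDualRep {k : Type u} {G : Type} [Field k] [Group G] (M : Rep.{u} k G) : Prop :=
  Nonempty (Representation.Equiv M.ρ M.ρ.dual)

/-- Isomorphism of `kG`-modules, on the type of self-dual irreducible `kG`-modules. -/
def selfDualIrrepSetoid (k : Type u) (G : Type) [Field k] [Group G] :
    Setoid {M : Rep.{u} k G // M.ρ.IsIrreducible ∧ IsSelfDualRep M} where
  r M N := Nonempty (Representation.Equiv M.1.ρ N.1.ρ)
  iseqv :=
    { refl := fun _ => ⟨Representation.Equiv.refl _⟩
      symm := fun ⟨e⟩ => ⟨e.symm⟩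
      trans := fun ⟨e⟩ ⟨f⟩ => ⟨e.trans f⟩ }

/-- The number of self-dual irreducible `kG`-modules, counted up to isomorphism. -/
noncomputable def numSelfDualIrreps (k : Type u) (G : Type) [Field k] [Group G] : ℕ :=
  Nat.card (Quotient (selfDualIrrepSetoid k G))

/-- The partitions of `n` into odd parts which have at least one repeated part. -/
def nonStrictOddPartitions (n : ℕ) : Finset (Nat.Partition n) :=
  Nat.Partition.odds n \ Nat.Partition.distincts n

/-- The partitions `μ` of `n` into distinct odd parts for which `(n - ℓ(μ)) / 2` is even, where
`ℓ(μ)` is the number of parts of `μ`. (As all parts are odd, `ℓ(μ) ≤ n` and `n - ℓ(μ)` is even.) -/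
def strictOddPartitionsEven (n : ℕ) : Finset (Nat.Partition n) :=
  (Nat.Partition.oddDistincts n).filter fun μ => Even ((n - μ.parts.card) / 2)

/-! Self-dual irreducible modules are counted by real conjugacy classes of elements of odd order
(`numSelfDualIrreps_eq_card_real_classes`), and these classes are then counted in the alternating
group (`alternatingGroup.card_real_oddConjClasses`).

Over a splitting field of characteristic 2, the `k`-valued irreducible characters, restricted to the
classes of odd order, form a basis of all functions on those classes. Independence follows from
Jacobson density. For spanning, the pullback of the indicator of a class along "odd part" takes
values in the prime field; compatibility with Frobenius makes its linear extension to the group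
algebra vanish on nilpotents, hence on the common annihilator of the irreducibles, and a symmetric
functional on a product of matrix algebras is a combination of traces. Duality permutes this basis
as inversion permutes the classes, so both involutions have equally many fixed points
(`card_fixedPoints_eq_of_basis`).

An odd-order permutation of cycle type `μ` is inverted by an involution with one fixed point per
cycle, of sign `(-1) ^ ((n - ℓ(μ)) / 2)`. If `μ` is not strict, the centralizer contains odd
permutations, so `μ` gives one class of the alternating group, and it is real. If `μ` is strict, the
centralizer is even, the class splits in two, and all inverting elements have the same sign; both
halves are real or neither is, according to the parity of `(n - ℓ(μ)) / 2`. -/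

open Module

/-! ### Traces and symmetric functionals on matrix algebras. -/

/-- In characteristic two, a symmetric double sum reduces to its diagonal. -/
theorem sum_sum_eq_sum_diag_of_charTwo {k ι : Type*} [CommRing k] [CharP k 2] [Fintype ι]
    (s : ι → ι → k) (hs : ∀ i j, s i j = s j i) : ∑ i, ∑ j, s i j = ∑ i, s i i := by
  classical
  rw [← Finset.sum_product', ← Finset.sum_filter_add_sum_filter_not _ (fun p : ι × ι => p.1 = p.2)]
  have h0 : ∑ p ∈ (Finset.univ ×ˢ Finset.univ : Finset (ι × ι)) with ¬ p.1 = p.2, s p.1 p.2 = 0 := by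
    refine Finset.sum_involution (fun p _ => (p.2, p.1)) ?_ ?_ ?_ ?_
    · intro p _
      rw [hs p.2 p.1]
      exact CharTwo.add_self_eq_zero _
    · intro p hp _ h
      simp only [Finset.mem_filter] at hp
      exact hp.2 (congrArg Prod.snd h)
    · intro p hp
      simp only [Finset.mem_filter, Finset.mem_product, Finset.mem_univ, true_and] at hp ⊢
      exact fun h => hp h.symm
    · intro p _
      rfl
  rw [h0, add_zero]
  refine Finset.sum_bij' (fun p _ => p.1) (fun i _ => (i, i)) ?_ ?_ ?_ ?_ ?_ <;> aesop

theorem LinearMap.trace_mul_self_of_charTwo {k V : Type*} [Field k] [CharP k 2] [AddCommGroup V]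
    [Module k V] [FiniteDimensional k V] (x : Module.End k V) :
    LinearMap.trace k V (x * x) = LinearMap.trace k V x ^ 2 := by
  let b := Module.finBasis k V
  rw [LinearMap.trace_eq_matrix_trace k b, LinearMap.trace_eq_matrix_trace k b,
    LinearMap.toMatrix_mul]
  simp only [Matrix.trace, Matrix.diag_apply, Matrix.mul_apply]
  rw [sum_sum_eq_sum_diag_of_charTwo _ (fun i j => mul_comm _ _), CharTwo.sum_sq]
  simp [sq]

/-- Every symmetrising functional on `End V` is a multiple of the trace. -/
theorem Module.End.exists_eq_mul_trace {k V : Type*} [Field k] [AddCommGroup V] [Module k V]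
    [FiniteDimensional k V] (F : Module.End k V →ₗ[k] k) (hF : ∀ x y, F (x * y) = F (y * x)) :
    ∃ c : k, ∀ x, F x = c * LinearMap.trace k V x := by
  rcases subsingleton_or_nontrivial V with h | h
  · refine ⟨0, fun x => ?_⟩
    rw [Subsingleton.elim x 0, map_zero, zero_mul]
  obtain ⟨v₀, hv₀⟩ := exists_ne (0 : V)
  obtain ⟨φ₀, hφ₀⟩ := Module.Projective.exists_dual_eq_one k hv₀
  -- Rank-one operators span, and each is a product of two rank-one operators whose product in the
  -- other order is a multiple of the fixed `φ₀ ⊗ v₀`.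
  have key : ∀ (φ : Module.Dual k V) (v : V),
      F (φ.smulRight v) = F (φ₀.smulRight v₀) * φ v := by
    intro φ v
    have h1 : φ.smulRight v = (φ₀.smulRight v : Module.End k V) * φ.smulRight v₀ := by
      ext w; simp [hφ₀]
    have h2 : (φ.smulRight v₀ : Module.End k V) * φ₀.smulRight v = φ v • φ₀.smulRight v₀ := by
      ext w
      simp only [Module.End.mul_apply, LinearMap.smulRight_apply, map_smul, LinearMap.smul_apply, smul_smul,
        mul_comm]
    rw [h1, hF, h2, map_smul, smul_eq_mul, mul_comm]
  refine ⟨F (φ₀.smulRight v₀), fun x => ?_⟩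
  let b := Module.finBasis k V
  have hx : x = ∑ i, (b.coord i).smulRight (x (b i)) := by
    refine b.ext fun j => ?_
    simp [LinearMap.sum_apply, Finsupp.single_apply]
  rw [hx, map_sum, map_sum, Finset.mul_sum]
  exact Finset.sum_congr rfl fun i _ => by rw [key, LinearMap.trace_smulRight]

/-! ### Characters of absolutely simple modules. -/

section Family

variable {k A ι : Type*} [Field k] [Ring A] [Algebra k A] {M : ι → Type*}
  [∀ i, AddCommGroup (M i)] [∀ i, Module k (M i)] [∀ i, Module A (M i)]
  [∀ i, IsScalarTower k A (M i)] [∀ i, IsSimpleModule A (M i)] [∀ i, FiniteDimensional k (M i)]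

/-- Density for finitely many pairwise non-isomorphic absolutely simple modules. -/
theorem exists_smul_eq_of_forall_end_scalar [Finite ι]
    (hend : ∀ i, ∀ f : M i →ₗ[A] M i, ∃ c : k, ∀ v, f v = c • v)
    (hne : ∀ i j, i ≠ j → IsEmpty (M i ≃ₗ[A] M j)) (T : ∀ i, Module.End k (M i)) :
    ∃ a : A, ∀ i (v : M i), a • v = T i v := by
  classical
  have := Fintype.ofFinite ι
  have hzero : ∀ i j, i ≠ j → ∀ f : M i →ₗ[A] M j, f = 0 := by
    intro i j hij f
    rcases LinearMap.bijective_or_eq_zero f with h | h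
    · exact ((hne i j hij).false (LinearEquiv.ofBijective f h)).elim
    · exact h
  -- By Schur, an `A`-endomorphism of the product is a scalar on each factor, so it commutes with
  -- every family `T`. Density therefore applies to `T`, tested on bases of the factors.
  have hφ : ∀ φ : Module.End A (Π i, M i), ∀ i, ∃ c : k, ∀ v : Π i, M i, φ v i = c • v i := by
    intro φ i
    obtain ⟨c, hc⟩ := hend i (LinearMap.proj i ∘ₗ φ ∘ₗ LinearMap.single A M i)
    refine ⟨c, fun v => ?_⟩
    conv_lhs => rw [← LinearMap.sum_single_apply M v, map_sum, Finset.sum_apply]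
    rw [Finset.sum_eq_single i]
    · exact hc (v i)
    · intro j _ hj
      exact LinearMap.congr_fun
        (hzero j i hj (LinearMap.proj i ∘ₗ φ ∘ₗ LinearMap.single A M j)) (v j)
    · simp
  let f : Module.End (Module.End A (Π i, M i)) (Π i, M i) :=
    { toFun := fun v i => T i (v i)
      map_add' := fun v w => by ext i; simp
      map_smul' := fun φ v => by
        ext i
        obtain ⟨c, hc⟩ := hφ φ i
        simp [hc] }
  let s : Finset (Π i, M i) := Finset.univ.biUnion fun i =>
    Finset.univ.image fun j => Pi.single i (Module.finBasis k (M i) j)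
  obtain ⟨a, ha⟩ := jacobson_density (R := A) f s
  refine ⟨a, fun i v => ?_⟩
  have : (Algebra.lsmul k k (M i) a : Module.End k (M i)) = T i := by
    refine (Module.finBasis k (M i)).ext fun j => ?_
    have := congrFun (ha (Pi.single i (Module.finBasis k (M i) j)) (by
      simp only [s, Finset.mem_biUnion, Finset.mem_univ, true_and, Finset.mem_image]
      exact ⟨i, j, rfl⟩)) i
    simpa [f] using this.symm
  exact LinearMap.congr_fun this v

variable (k A M) in
/-- The character of the `i`-th module, as a functional on the algebra. -/
noncomputable def moduleCharacter (i : ι) : A →ₗ[k] k :=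
  LinearMap.trace k (M i) ∘ₗ (Algebra.lsmul k k (M i)).toLinearMap

/-- Density gives an algebra element acting on one module as a rank-one operator of trace 1 and as
zero on the others in the relation. Only finitely many modules enter at a time, so the index type
may be arbitrary; its finiteness is later deduced from this. -/
theorem linearIndependent_moduleCharacter
    (hend : ∀ i, ∀ f : M i →ₗ[A] M i, ∃ c : k, ∀ v, f v = c • v)
    (hne : ∀ i j, i ≠ j → IsEmpty (M i ≃ₗ[A] M j)) :
    LinearIndependent k (moduleCharacter k A M) := by
  classical
  rw [linearIndependent_iff']
  intro s c hc i hi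
  have : Nontrivial (M i) := IsSimpleModule.nontrivial A (M i)
  obtain ⟨v₀, hv₀⟩ := exists_ne (0 : M i)
  obtain ⟨φ₀, hφ₀⟩ := Module.Projective.exists_dual_eq_one k hv₀
  obtain ⟨a, ha⟩ := exists_smul_eq_of_forall_end_scalar (M := fun j : s => M j)
    (fun j => hend j) (fun j l hjl => hne j l (Subtype.coe_injective.ne hjl))
    (Pi.single ⟨i, hi⟩ (φ₀.smulRight v₀))
  have hχ : ∀ j (hj : j ∈ s), moduleCharacter k A M j a =
      LinearMap.trace k (M j) ((Pi.single (M := fun j : s => Module.End k (M j))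
        ⟨i, hi⟩ (φ₀.smulRight v₀)) ⟨j, hj⟩) := by
    intro j hj
    refine congrArg (LinearMap.trace k (M j)) ?_
    ext v
    exact ha ⟨j, hj⟩ v
  have h := LinearMap.congr_fun hc a
  rw [LinearMap.sum_apply, Finset.sum_eq_single i] at h
  · rw [LinearMap.smul_apply, hχ i hi, Pi.single_eq_same, LinearMap.trace_smulRight, hφ₀] at h
    simpa using h
  · intro j hj hji
    rw [LinearMap.smul_apply, hχ j hj, Pi.single_eq_of_ne (by simpa using hji)]
    simp
  · exact fun h => (h hi).elim

/-- By `hann`, `f` factors through the image of `A` in the product of the `End (M i)`, which is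
everything by density. On each factor the induced functional is symmetric, hence a multiple of the
trace. -/
theorem exists_eq_sum_moduleCharacter [Fintype ι]
    (hend : ∀ i, ∀ f : M i →ₗ[A] M i, ∃ c : k, ∀ v, f v = c • v)
    (hne : ∀ i j, i ≠ j → IsEmpty (M i ≃ₗ[A] M j))
    (f : A →ₗ[k] k) (hf : ∀ a b, f (a * b) = f (b * a))
    (hann : ∀ a, (∀ i (v : M i), a • v = 0) → f a = 0) :
    ∃ c : ι → k, f = ∑ i, c i • moduleCharacter k A M i := by
  classical
  let π : A →ₗ[k] (Π i, Module.End k (M i)) :=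
    LinearMap.pi fun i => (Algebra.lsmul k k (M i)).toLinearMap
  have hπ : ∀ a i (v : M i), π a i v = a • v := fun _ _ _ => rfl
  have hsurj : Function.Surjective π := by
    intro T
    obtain ⟨a, ha⟩ := exists_smul_eq_of_forall_end_scalar hend hne T
    exact ⟨a, by ext i v; exact ha i v⟩
  have hker : ∀ a b, π a = π b → f a = f b := by
    intro a b hab
    rw [← sub_eq_zero, ← map_sub]
    refine hann _ fun i v => ?_
    rw [sub_smul, ← hπ, ← hπ, hab, sub_self]
  have hmul : ∀ a b, π (a * b) = π a * π b := by
    intro a b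
    ext i v
    simp [hπ, mul_smul]
  obtain ⟨s, hs⟩ := LinearMap.exists_rightInverse_of_surjective π (LinearMap.range_eq_top.2 hsurj)
  have hs' : ∀ T, π (s T) = T := fun T => LinearMap.congr_fun hs T
  have hF : ∀ T U, f (s (T * U)) = f (s (U * T)) := by
    intro T U
    rw [hker (s (T * U)) (s T * s U) (by rw [hmul, hs', hs', hs']),
      hker (s (U * T)) (s U * s T) (by rw [hmul, hs', hs', hs']), hf]
  have hc : ∀ i, ∃ c : k, ∀ x, (f ∘ₗ s ∘ₗ LinearMap.single k _ i) x =
      c * LinearMap.trace k (M i) x := fun i =>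
    Module.End.exists_eq_mul_trace (f ∘ₗ s ∘ₗ LinearMap.single k (fun i => Module.End k (M i)) i) fun x y => by
      change f (s (Pi.single i (x * y))) = f (s (Pi.single i (y * x)))
      rw [Pi.single_mul, Pi.single_mul, hF]
  choose c hc using hc
  refine ⟨c, LinearMap.ext fun a => ?_⟩
  rw [hker a (s (π a)) (hs' _).symm]
  conv_lhs => rw [← LinearMap.sum_single_apply (fun i => Module.End k (M i)) (π a), map_sum, map_sum]
  rw [LinearMap.sum_apply]
  exact Finset.sum_congr rfl fun i _ => hc i (π a i)

end Family

/-! ### Brauer's permutation lemma in characteristic two. -/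

/-- In characteristic two the number of fixed points of a permutation of order two can be read off
from the induced linear map. -/
theorem card_fixedPoints_add_finrank_range_funLeft {k ι : Type*} [Field k] [CharP k 2] [Fintype ι]
    (σ : ι → ι) (hσ : Function.Involutive σ) :
    Nat.card {i // σ i = i} +
      2 * finrank k (LinearMap.range (LinearMap.id + LinearMap.funLeft k k σ)) =
      Fintype.card ι := by
  classical
  -- The trace sees fixed points only modulo 2, so the rank of `D = 1 + σ` is used instead.
  -- Restriction to the fixed points maps `ker D` onto all functions there, with kernel `range D`.
  let D : (ι → k) →ₗ[k] (ι → k) := LinearMap.id + LinearMap.funLeft k k σ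
  have hD : ∀ f i, D f i = f i + f (σ i) := fun _ _ => rfl
  have hDker : ∀ f, f ∈ LinearMap.ker D ↔ ∀ i, f (σ i) = f i := by
    intro f
    rw [LinearMap.mem_ker, funext_iff]
    refine forall_congr' fun i => ?_
    rw [hD, Pi.zero_apply, CharTwo.add_eq_zero, eq_comm]
  let R : LinearMap.ker D →ₗ[k] ({i // σ i = i} → k) :=
    LinearMap.funLeft k k Subtype.val ∘ₗ (LinearMap.ker D).subtype
  have hR : Function.Surjective R := by
    intro g
    refine ⟨⟨fun i => if h : σ i = i then g ⟨i, h⟩ else 0, (hDker _).2 fun i => ?_⟩, ?_⟩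
    · by_cases h : σ i = i
      · simp only [h]
      · have : ¬ σ (σ i) = σ i := fun h' => h (hσ.injective h')
        simp [h, this]
    · ext ⟨i, hi⟩
      simp [R, LinearMap.funLeft_apply, hi]
  obtain ⟨lt⟩ : Nonempty (LinearOrder ι) := ⟨linearOrderOfSTO (WellOrderingRel (α := ι))⟩
  have hRker : (LinearMap.ker R).map (LinearMap.ker D).subtype = LinearMap.range D := by
    ext f
    constructor
    · rintro ⟨⟨f, hf⟩, hf', rfl⟩
      rw [hDker] at hf
      -- The order selects one point of each two-element orbit; an invariant function vanishing at
      -- the fixed points is recovered from its values there.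
      refine ⟨fun i => if i < σ i then f i else 0, funext fun i => ?_⟩
      rw [hD, hσ i]
      rcases lt_trichotomy i (σ i) with h | h | h
      · simp [h, h.le.not_gt]
      · have := congrFun hf' ⟨i, h.symm⟩
        simp only [← h, lt_irrefl, if_false, add_zero]
        exact this.symm
      · simp [h, h.le.not_gt, hf]
    · rintro ⟨f, rfl⟩
      refine ⟨⟨D f, (hDker _).2 fun i => ?_⟩, ?_, rfl⟩
      · rw [hD, hD, hσ i, add_comm]
      · ext ⟨i, hi⟩
        change D f i = 0
        rw [hD, hi, CharTwo.add_self_eq_zero]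
  have h1 := LinearMap.finrank_range_add_finrank_ker D
  have h2 := LinearMap.finrank_range_add_finrank_ker R
  rw [LinearMap.range_eq_top.2 hR, finrank_top, Module.finrank_fintype_fun_eq_card] at h2
  have h3 : finrank k (LinearMap.ker R) = finrank k (LinearMap.range D) := by
    rw [← hRker]
    exact (LinearEquiv.finrank_eq (Submodule.equivMapOfInjective _
      (Submodule.injective_subtype _) _))
  rw [Module.finrank_fintype_fun_eq_card] at h1
  rw [Nat.card_eq_fintype_card]
  change _ + 2 * finrank k (LinearMap.range D) = _
  omega

/-- Brauer's permutation lemma for involutions, in characteristic two. -/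
theorem card_fixedPoints_eq_of_basis {k ι κ : Type*} [Field k] [CharP k 2] [Fintype ι] [Fintype κ]
    (b : Basis ι k (κ → k)) (σ : ι → ι) (hσ : Function.Involutive σ) (τ : κ → κ)
    (hτ : Function.Involutive τ) (h : ∀ i x, b (σ i) x = b i (τ x)) :
    Nat.card {i // σ i = i} = Nat.card {x // τ x = x} := by
  have h1 := card_fixedPoints_add_finrank_range_funLeft (k := k) σ hσ
  have h2 := card_fixedPoints_add_finrank_range_funLeft (k := k) τ hτ
  have hcard : Fintype.card ι = Fintype.card κ := by
    rw [← Module.finrank_eq_card_basis b, Module.finrank_fintype_fun_eq_card]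
  let e := b.equivFun
  have he : (LinearMap.id + LinearMap.funLeft k k σ) ∘ₗ e.toLinearMap =
      e.toLinearMap ∘ₗ (LinearMap.id + LinearMap.funLeft k k τ) := by
    refine b.ext fun i => ?_
    have hb : LinearMap.funLeft k k τ (b i) = b (σ i) := funext fun x => (h i x).symm
    simp only [LinearMap.comp_apply, LinearMap.add_apply, LinearMap.id_apply, hb, map_add,
      LinearEquiv.coe_coe]
    congr 1
    ext j
    classical
    simp only [e, LinearMap.funLeft_apply, Basis.equivFun_self]
    simp only [hσ.eq_iff]
  have hr : finrank k (LinearMap.range (LinearMap.id + LinearMap.funLeft k k σ)) =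
      finrank k (LinearMap.range (LinearMap.id + LinearMap.funLeft k k τ)) := by
    rw [← LinearEquiv.range_comp e (LinearMap.id + LinearMap.funLeft k k σ)]
    erw [he]
    rw [LinearMap.range_comp]
    exact (LinearEquiv.finrank_map_eq e _)
  omega

/-! ### Elements of odd order and their conjugacy classes. -/

section OddPart

variable (G : Type*) [Group G]

/-- Some power of two projects a finite group onto its elements of odd order. -/
theorem exists_two_pow_projection [Finite G] : ∃ N : ℕ, 0 < N ∧ ∀ g : G,
    Odd (orderOf (g ^ 2 ^ N)) ∧ (Odd (orderOf g) → g ^ 2 ^ N = g) := by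
  obtain ⟨a, m, hm, hc⟩ := Nat.exists_eq_two_pow_mul_odd (Nat.card_pos (α := G)).ne'
  have hmpos : 0 < m := hm.pos
  have hφ : 0 < m.totient := Nat.totient_pos.2 hmpos
  -- Being a multiple of `φ(m)`, the exponent makes `2 ^ N ≡ 1` modulo `m`; being at least `a`, it
  -- kills the 2-part; and `a + 1` keeps it positive.
  refine ⟨m.totient * (a + 1), Nat.mul_pos hφ a.succ_pos, fun g => ⟨?_, fun hg => ?_⟩⟩
  · refine hm.of_dvd_nat (orderOf_dvd_of_pow_eq_one ?_)
    rw [← pow_mul, ← orderOf_dvd_iff_pow_eq_one]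
    refine (orderOf_dvd_natCard g).trans (hc ▸ Nat.mul_dvd_mul_right (pow_dvd_pow 2 ?_) m)
    nlinarith
  · have hdvd : orderOf g ∣ m := by
      refine Nat.Coprime.dvd_of_dvd_mul_left ?_ (hc ▸ orderOf_dvd_natCard g)
      exact (Nat.coprime_two_right.2 hg).pow_right a
    have h2 : 2 ^ (m.totient * (a + 1)) ≡ 1 [MOD m] := by
      have := (Nat.ModEq.pow_totient (Nat.coprime_two_left.2 hm)).pow (a + 1)
      rwa [one_pow, ← pow_mul] at this
    conv_rhs => rw [← pow_one g]
    exact pow_eq_pow_iff_modEq.2 (h2.of_dvd hdvd)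

/-- The conjugacy classes of elements of odd order. -/
abbrev OddConjClasses := {c : ConjClasses G // ∃ g, ConjClasses.mk g = c ∧ Odd (orderOf g)}

variable {G}

theorem IsConj.orderOf_eq {g h : G} (hgh : IsConj g h) : orderOf g = orderOf h := by
  obtain ⟨c, rfl⟩ := isConj_iff.1 hgh
  exact ((MulAut.conj c).orderOf_eq g).symm

theorem IsConj.inv_inv {g h : G} (hgh : IsConj g h) : IsConj g⁻¹ h⁻¹ := by
  obtain ⟨c, rfl⟩ := isConj_iff.1 hgh
  exact isConj_iff.2 ⟨c, by group⟩

namespace OddConjClasses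

/-- The class of an element of odd order. -/
def mk (g : G) (hg : Odd (orderOf g)) : OddConjClasses G := ⟨ConjClasses.mk g, g, rfl, hg⟩

theorem mk_eq_mk_iff {g h : G} {hg : Odd (orderOf g)} {hh : Odd (orderOf h)} :
    mk g hg = mk h hh ↔ IsConj g h := by
  rw [mk, mk, Subtype.mk.injEq, ConjClasses.mk_eq_mk_iff_isConj]

/-- A representative of a class. -/
noncomputable def rep (c : OddConjClasses G) : G := c.2.choose

theorem odd_orderOf_rep (c : OddConjClasses G) : Odd (orderOf c.rep) := c.2.choose_spec.2

theorem mk_rep (c : OddConjClasses G) : mk c.rep c.odd_orderOf_rep = c :=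
  Subtype.ext c.2.choose_spec.1

theorem isConj_rep_mk (g : G) (hg : Odd (orderOf g)) : IsConj (mk g hg).rep g :=
  mk_eq_mk_iff.1 (mk_rep (mk g hg))

/-- The class of the inverses. -/
noncomputable def inv (c : OddConjClasses G) : OddConjClasses G :=
  mk c.rep⁻¹ (by rw [orderOf_inv]; exact c.odd_orderOf_rep)

theorem isConj_rep_inv (c : OddConjClasses G) : IsConj c.inv.rep c.rep⁻¹ := isConj_rep_mk _ _

theorem inv_involutive : Function.Involutive (inv : OddConjClasses G → OddConjClasses G) := by
  intro c
  conv_rhs => rw [← mk_rep c]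
  refine mk_eq_mk_iff.2 ?_
  simpa using c.isConj_rep_inv.inv_inv

theorem inv_eq_self_iff (c : OddConjClasses G) : c.inv = c ↔ IsConj c.rep c.rep⁻¹ := by
  conv_lhs => rhs; rw [← mk_rep c]
  exact mk_eq_mk_iff.trans isConj_comm

end OddConjClasses

end OddPart

/-! ### Symmetric functionals on the group algebra and Frobenius. -/

section ClassFunctional

open scoped MonoidAlgebra

variable {k : Type*} [Field k] {G : Type*}

/-- The linear extension of a function on `G` to the group algebra. -/
noncomputable def groupAlgebraFunctional (φ : G → k) : k[G] →ₗ[k] k :=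
  (MonoidAlgebra.basis G k).constr k φ

theorem groupAlgebraFunctional_single (φ : G → k) (g : G) :
    groupAlgebraFunctional φ (MonoidAlgebra.single g 1) = φ g := by
  rw [← MonoidAlgebra.basis_apply]
  exact Basis.constr_basis _ _ _ _

theorem groupAlgebra_functional_ext {f f' : k[G] →ₗ[k] k}
    (h : ∀ g, f (MonoidAlgebra.single g 1) = f' (MonoidAlgebra.single g 1)) : f = f' :=
  (MonoidAlgebra.basis G k).ext fun g => by simpa [MonoidAlgebra.basis_apply] using h g

variable [Group G]

theorem groupAlgebraFunctional_mul_comm (φ : G → k) (hφ : ∀ g h, φ (g * h) = φ (h * g))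
    (a b : k[G]) : groupAlgebraFunctional φ (a * b) = groupAlgebraFunctional φ (b * a) := by
  have : (LinearMap.mul k k[G]).compr₂ (groupAlgebraFunctional φ) =
      (LinearMap.mul k k[G]).flip.compr₂ (groupAlgebraFunctional φ) := by
    refine (MonoidAlgebra.basis G k).ext fun g => (MonoidAlgebra.basis G k).ext fun h => ?_
    simp only [LinearMap.compr₂_apply, LinearMap.flip_apply, LinearMap.mul_apply',
      MonoidAlgebra.basis_apply, MonoidAlgebra.single_mul_single, one_mul,
      groupAlgebraFunctional_single, hφ g h]
  exact LinearMap.congr_fun₂ this a b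

variable [CharP k 2] [Finite G]

/-- Cross terms of the square cancel in pairs by symmetry of `φ`. The diagonal sum `∑ c_g² φ(g²)` is
a square because `hφ2` puts the values of `φ` in the prime field. -/
theorem groupAlgebraFunctional_sq (φ : G → k) (hφ : ∀ g h, φ (g * h) = φ (h * g))
    (hφ2 : ∀ g, φ g ^ 2 = φ g) (a : k[G]) :
    groupAlgebraFunctional φ (a ^ 2) = groupAlgebraFunctional (fun g => φ (g ^ 2)) a ^ 2 := by
  have := Fintype.ofFinite G
  let b := MonoidAlgebra.basis G k
  have ha : a = ∑ g, b.repr a g • MonoidAlgebra.single g 1 := by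
    conv_lhs => rw [← b.sum_repr a]
    simp [b, MonoidAlgebra.basis_apply]
  generalize b.repr a = c at ha
  subst ha
  rw [map_sum, CharTwo.sum_sq, sq, Finset.sum_mul_sum, map_sum]
  simp only [map_sum, smul_mul_smul_comm, MonoidAlgebra.single_mul_single, one_mul, map_smul,
    groupAlgebraFunctional_single, smul_eq_mul]
  rw [sum_sum_eq_sum_diag_of_charTwo _ fun g h => by rw [hφ g h, mul_comm (c g)]]
  refine Finset.sum_congr rfl fun g _ => ?_
  rw [mul_pow, hφ2, sq, sq]

theorem groupAlgebraFunctional_two_pow (n : ℕ) (φ : G → k) (hφ : ∀ g h, φ (g * h) = φ (h * g))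
    (hφ2 : ∀ g, φ g ^ 2 = φ g) (a : k[G]) :
    groupAlgebraFunctional φ (a ^ 2 ^ n) =
      groupAlgebraFunctional (fun g => φ (g ^ 2 ^ n)) a ^ 2 ^ n := by
  induction n generalizing φ with
  | zero => simp
  | succ n ih =>
    have hsq : ∀ g h : G, φ ((g * h) ^ 2) = φ ((h * g) ^ 2) := by
      intro g h
      have h1 : (g * h) ^ 2 = g * (h * g * h) := by simp only [sq, mul_assoc]
      have h2 : (h * g) ^ 2 = (h * g * h) * g := by simp only [sq, mul_assoc]
      rw [h1, h2, hφ]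
    rw [pow_succ, pow_mul, groupAlgebraFunctional_sq φ hφ hφ2, ih (fun g => φ (g ^ 2)) hsq fun g => hφ2 _]
    simp only [← pow_mul]

/-- A `{0,1}`-valued class function depending only on the odd part vanishes on nilpotents. -/
theorem groupAlgebraFunctional_eq_zero_of_isNilpotent {N : ℕ} (hN : 0 < N) (φ : G → k)
    (hφ : ∀ g h, φ (g * h) = φ (h * g)) (hφ2 : ∀ g, φ g ^ 2 = φ g)
    (hφN : ∀ g, φ (g ^ 2 ^ N) = φ g) {a : k[G]} (ha : IsNilpotent a) :
    groupAlgebraFunctional φ a = 0 := by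
  obtain ⟨m, hm⟩ := ha
  have hiter : ∀ t g, φ (g ^ 2 ^ (N * t)) = φ g := by
    intro t
    induction t with
    | zero => simp
    | succ t ih => intro g; rw [Nat.mul_succ, pow_add, pow_mul, hφN, ih]
  -- This power of `a` is zero, while `φ` is unchanged by the same power map on `G`; hence a power
  -- of the value at `a` vanishes.
  have h := groupAlgebraFunctional_two_pow (N * m) φ hφ hφ2 a
  have hle : m ≤ 2 ^ (N * m) :=
    (Nat.le_mul_of_pos_left m hN).trans (Nat.lt_two_pow_self).le
  rw [pow_eq_zero_of_le hle hm, map_zero] at h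
  simp only [hiter] at h
  exact pow_eq_zero_iff (by positivity) |>.1 h.symm

end ClassFunctional

/-! ### Irreducible representations as simple modules. -/

section Irreps

open scoped MonoidAlgebra
open Representation

instance (k : Type*) [Field k] (G : Type*) [Group G] [Finite G] : Module.Finite k k[G] :=
  Module.Finite.of_basis (MonoidAlgebra.basis G k)

theorem Representation.IsIrreducible.finiteDimensional {k G V : Type*} [Field k] [Group G]
    [Finite G] [AddCommGroup V] [Module k V] {ρ : Representation k G V} (hρ : ρ.IsIrreducible) :
    FiniteDimensional k V := by
  have : Module.Finite k ρ.asModule := Module.Finite.trans k[G] ρ.asModule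
  exact Module.Finite.equiv ρ.asModuleEquiv

/-- Annihilators match the subrepresentations of the dual with those of `ρ`; finite dimension
ensures that the double annihilator gives back `W`. -/
theorem Representation.IsIrreducible.dual {k G V : Type*} [Field k] [Group G]
    [AddCommGroup V] [Module k V] [FiniteDimensional k V] {ρ : Representation k G V}
    (hρ : ρ.IsIrreducible) : ρ.dual.IsIrreducible := by
  have hV : Nontrivial V := IsSimpleModule.nontrivial k[G] ρ.asModule
  have hsub : ∀ W : Subrepresentation ρ, W.toSubmodule = ⊥ ∨ W.toSubmodule = ⊤ := by
    intro W
    rcases eq_bot_or_eq_top W with h | h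
    · left; rw [h]; rfl
    · right; rw [h]; rfl
  have hinv : ∀ (g : G) (φ : Dual k V) (v : V), ρ.dual g φ v = φ (ρ g⁻¹ v) := fun _ _ _ => rfl
  have hbot : (⊥ : Subrepresentation ρ.dual).toSubmodule = ⊥ := rfl
  have htop : (⊤ : Subrepresentation ρ.dual).toSubmodule = ⊤ := rfl
  refine { exists_pair_ne := ⟨⊥, ⊤, fun h => ?_⟩, eq_bot_or_eq_top := fun W => ?_ }
  · have := congrArg Subrepresentation.toSubmodule h
    rw [hbot, htop] at this
    exact bot_ne_top this
  · let U : Subrepresentation ρ := ⟨W.toSubmodule.dualCoannihilator, fun g v hv => by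
      rw [Submodule.mem_dualCoannihilator] at hv ⊢
      intro φ hφ
      simpa only [hinv, inv_inv] using hv _ (W.apply_mem_toSubmodule g⁻¹ hφ)⟩
    have hU : U.toSubmodule.dualAnnihilator = W.toSubmodule :=
      Subspace.dualCoannihilator_dualAnnihilator_eq
    rcases hsub U with h | h
    · right
      apply Subrepresentation.toSubmodule_injective
      rw [← hU, h, htop, Submodule.dualAnnihilator_bot]
    · left
      apply Subrepresentation.toSubmodule_injective
      rw [← hU, h, hbot, Submodule.dualAnnihilator_top]

/-- Isomorphism of irreducible `kG`-modules. -/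
def irrepSetoid (k : Type u) (G : Type) [Field k] [Group G] :
    Setoid {M : Rep.{u} k G // M.ρ.IsIrreducible} where
  r M N := Nonempty (Representation.Equiv M.1.ρ N.1.ρ)
  iseqv :=
    { refl := fun _ => ⟨Representation.Equiv.refl _⟩
      symm := fun ⟨e⟩ => ⟨e.symm⟩
      trans := fun ⟨e⟩ ⟨f⟩ => ⟨e.trans f⟩ }

/-- The isomorphism classes of irreducible `kG`-modules. -/
abbrev Irrep (k : Type u) (G : Type) [Field k] [Group G] := Quotient (irrepSetoid k G)

namespace Irrep

variable {k : Type u} {G : Type} [Field k] [Group G]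

/-- The class of an irreducible representation. -/
def mk {V : Type u} [AddCommGroup V] [Module k V] (ρ : Representation k G V)
    (hρ : ρ.IsIrreducible) : Irrep k G :=
  Quotient.mk (irrepSetoid k G) ⟨Rep.of ρ, hρ⟩

theorem mk_eq_mk_iff {V W : Type u} [AddCommGroup V] [Module k V] [AddCommGroup W] [Module k W]
    {ρ : Representation k G V} {hρ : ρ.IsIrreducible}
    {σ : Representation k G W} {hσ : σ.IsIrreducible} :
    mk ρ hρ = mk σ hσ ↔ Nonempty (ρ.Equiv σ) := by
  rw [mk, mk, Quotient.eq]
  rfl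

/-- A representation in an isomorphism class. -/
noncomputable def rep (i : Irrep k G) : Rep.{u} k G := (Quotient.out i).1

theorem isIrreducible_rep (i : Irrep k G) : i.rep.ρ.IsIrreducible := (Quotient.out i).2

theorem mk_rep (i : Irrep k G) : mk i.rep.ρ i.isIrreducible_rep = i := Quotient.out_eq i

/-- The underlying module over the group algebra. -/
abbrev M (i : Irrep k G) : Type u := i.rep.ρ.asModule

instance (i : Irrep k G) : IsSimpleModule k[G] i.M :=
  (irreducible_iff_isSimpleModule_asModule _).1 i.isIrreducible_rep

instance [Finite G] (i : Irrep k G) : FiniteDimensional k i.rep :=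
  i.isIrreducible_rep.finiteDimensional

instance [Finite G] (i : Irrep k G) : FiniteDimensional k i.M :=
  i.isIrreducible_rep.finiteDimensional

/-- The character of an isomorphism class. -/
noncomputable def char (i : Irrep k G) : G → k := i.rep.ρ.character

theorem char_mk {V : Type u} [AddCommGroup V] [Module k V] (ρ : Representation k G V)
    (hρ : ρ.IsIrreducible) : (mk ρ hρ).char = ρ.character := by
  obtain ⟨e⟩ := mk_eq_mk_iff.1 (mk_rep (mk ρ hρ))
  exact char_iso e

theorem moduleCharacter_single (i : Irrep k G) (g : G) :
    moduleCharacter k k[G] M i (MonoidAlgebra.single g 1) = i.char g := by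
  refine congrArg (LinearMap.trace k i.rep) ?_
  ext v
  exact (single_smul (ρ := i.rep.ρ) 1 g v).trans (one_smul k _)

theorem end_scalar (hk : IsSplittingFieldFor k G) (i : Irrep k G) (f : i.M →ₗ[k[G]] i.M) :
    ∃ c : k, ∀ v, f v = c • v :=
  hk _ i.rep.ρ i.isIrreducible_rep ((IntertwiningMap.equivLinearMapAsModule _ _).symm f)

theorem isEmpty_equiv (i j : Irrep k G) (hij : i ≠ j) : IsEmpty (i.M ≃ₗ[k[G]] j.M) := by
  refine ⟨fun e => hij ?_⟩
  rw [← mk_rep i, ← mk_rep j, mk_eq_mk_iff]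
  exact ⟨((IntertwiningMap.equivLinearMapAsModule i.rep.ρ j.rep.ρ).symm e.toLinearMap).ofBijective
    e.bijective⟩

variable [Finite G]

theorem linearIndependent_moduleCharacter (hk : IsSplittingFieldFor k G) :
    LinearIndependent k (moduleCharacter k k[G] (M : Irrep k G → Type u)) :=
  _root_.linearIndependent_moduleCharacter (end_scalar hk) isEmpty_equiv

theorem finite (hk : IsSplittingFieldFor k G) : Finite (Irrep k G) :=
  (linearIndependent_moduleCharacter hk).finite

/-- An element of the group algebra killing all irreducible modules is nilpotent. -/
theorem isNilpotent_of_forall_smul_eq_zero (a : k[G]) (ha : ∀ (i : Irrep k G) (v : i.M), a • v = 0) :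
    IsNilpotent a := by
  have : IsArtinianRing k[G] := IsArtinianRing.of_finite k k[G]
  -- For a maximal left ideal `m`, the simple quotient `k[G] ⧸ m` is among the irreducibles, so `a`
  -- kills the class of 1 and lies in `m`. The radical of an Artinian ring is nilpotent.
  have hmem : a ∈ Ring.jacobson k[G] := by
    rw [Ring.jacobson_eq_sInf_isMaximal, Submodule.mem_sInf]
    intro m hm
    have : IsSimpleModule k[G] (k[G] ⧸ m) := isSimpleModule_iff_isCoatom.2 (Ideal.isMaximal_def.1 hm)
    let ρ : Representation k G (k[G] ⧸ m) := ofModule' (k[G] ⧸ m)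
    have hρa : ∀ r v, ρ.asAlgebraHom r v = r • v := by
      intro r v
      simp [ρ, asAlgebraHom, ofModule']
    have hρ : ρ.IsIrreducible := by
      rw [irreducible_iff_isSimpleModule_asModule]
      let e : ρ.asModule ≃ₗ[k[G]] (k[G] ⧸ m) :=
        { ρ.asModuleEquiv.toAddEquiv with map_smul' := fun r v => hρa r (ρ.asModuleEquiv v) }
      exact IsSimpleModule.congr e
    obtain ⟨e⟩ := mk_eq_mk_iff.1 (mk_rep (mk ρ hρ))
    let e' := IntertwiningMap.equivLinearMapAsModule _ _ e.toIntertwiningMap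
    obtain ⟨v, hv⟩ := e.surjective (Submodule.Quotient.mk 1)
    have h0 : a • (Submodule.Quotient.mk 1 : k[G] ⧸ m) = 0 := by
      rw [← hρa, ← hv]
      have h1 := e'.map_smul a v
      have h2 := (congrArg e' (ha _ v)).trans (map_zero e')
      exact (h1.symm.trans h2)
    rw [← Submodule.Quotient.mk_smul, Submodule.Quotient.mk_eq_zero] at h0
    simpa using h0
  obtain ⟨n, hn⟩ := IsSemiprimaryRing.isNilpotent (R := k[G])
  exact ⟨n, by simpa [hn] using Ideal.pow_mem_pow hmem n⟩

end Irrep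

end Irreps

/-! ### Characters on odd-order classes, and duality. -/

section SelfDual

open scoped MonoidAlgebra

namespace Irrep

variable {k : Type u} {G : Type} [Field k] [Group G]

theorem char_eq_of_isConj (i : Irrep k G) {g h : G} (hgh : IsConj g h) : i.char g = i.char h := by
  obtain ⟨c, rfl⟩ := isConj_iff.1 hgh
  exact (Representation.char_conj i.rep.ρ g c).symm

variable [Finite G]

theorem char_sq [CharP k 2] (i : Irrep k G) (g : G) : i.char (g ^ 2) = i.char g ^ 2 := by
  rw [char, Representation.character, map_pow, sq, LinearMap.trace_mul_self_of_charTwo]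
  rfl

theorem char_two_pow [CharP k 2] (i : Irrep k G) (n : ℕ) (g : G) :
    i.char (g ^ 2 ^ n) = i.char g ^ 2 ^ n := by
  induction n with
  | zero => simp
  | succ n ih => rw [pow_succ, pow_mul, char_sq, ih, pow_mul]

/-- Brauer characters in characteristic two only depend on the odd part. -/
theorem char_odd_part [CharP k 2] {N : ℕ} {g : G}
    (hN : (g ^ 2 ^ N) ^ 2 ^ N = g ^ 2 ^ N) (i : Irrep k G) : i.char (g ^ 2 ^ N) = i.char g := by
  -- The values at `g` and at `g ^ 2 ^ N` have the same `2 ^ N`-th power, and Frobenius is injective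
  -- on a field.
  have h1 := i.char_two_pow N (g ^ 2 ^ N)
  rw [hN] at h1
  conv_lhs at h1 => rw [char_two_pow]
  exact (iterateFrobenius_inj k 2 N h1).symm

theorem char_injective (hk : IsSplittingFieldFor k G) :
    Function.Injective (char : Irrep k G → G → k) := by
  intro i j hij
  refine (linearIndependent_moduleCharacter hk).injective ?_
  exact groupAlgebra_functional_ext fun g => by
    rw [moduleCharacter_single, moduleCharacter_single, hij]

/-- The isomorphism class of the dual. -/
noncomputable def dual (i : Irrep k G) : Irrep k G := mk i.rep.ρ.dual i.isIrreducible_rep.dual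

theorem char_dual (i : Irrep k G) (g : G) : i.dual.char g = i.char g⁻¹ := by
  rw [dual, char_mk, Representation.char_dual]
  rfl

theorem dual_involutive (hk : IsSplittingFieldFor k G) :
    Function.Involutive (dual : Irrep k G → Irrep k G) := fun i =>
  char_injective hk (funext fun g => by rw [char_dual, char_dual, inv_inv])

theorem dual_mk (hk : IsSplittingFieldFor k G) {V : Type u} [AddCommGroup V] [Module k V]
    [FiniteDimensional k V] (ρ : Representation k G V) (hρ : ρ.IsIrreducible) :
    (mk ρ hρ).dual = mk ρ.dual hρ.dual :=
  char_injective hk (funext fun g => by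
    rw [char_dual, char_mk, char_mk, Representation.char_dual])

/-- The values of the irreducible characters at the classes of elements of odd order. -/
noncomputable def charOnOdd (i : Irrep k G) : OddConjClasses G → k := fun c => i.char c.rep

/-- A relation on the odd-order classes extends to all of `G`, because each character takes the same
value at `g` and at its odd part. -/
theorem linearIndependent_charOnOdd [CharP k 2] (hk : IsSplittingFieldFor k G) :
    LinearIndependent k (charOnOdd : Irrep k G → OddConjClasses G → k) := by
  obtain ⟨N, -, hN⟩ := exists_two_pow_projection G
  have hli := linearIndependent_moduleCharacter hk
  rw [linearIndependent_iff'] at hli ⊢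
  intro s c hc
  refine hli s c (groupAlgebra_functional_ext fun g => ?_)
  have h := congrFun hc (OddConjClasses.mk (g ^ 2 ^ N) (hN g).1)
  simp only [Finset.sum_apply, Pi.smul_apply, Pi.zero_apply, LinearMap.sum_apply,
    LinearMap.smul_apply, LinearMap.zero_apply, moduleCharacter_single] at h ⊢
  rw [← h]
  refine Finset.sum_congr rfl fun i _ => ?_
  rw [charOnOdd, i.char_eq_of_isConj (OddConjClasses.isConj_rep_mk _ _),
    char_odd_part ((hN _).2 (hN g).1)]

/-- The indicator of a class, pulled back along `g ↦ g ^ 2 ^ N`, extends to a symmetric functional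
on the group algebra killing nilpotents, so it is a combination of irreducible characters. -/
theorem top_le_span_charOnOdd [CharP k 2] (hk : IsSplittingFieldFor k G) :
    ⊤ ≤ Submodule.span k (Set.range (charOnOdd : Irrep k G → OddConjClasses G → k)) := by
  classical
  have := finite hk
  have := Fintype.ofFinite (Irrep k G)
  obtain ⟨N, hN0, hN⟩ := exists_two_pow_projection G
  rw [← (Pi.basisFun k (OddConjClasses G)).span_eq, Submodule.span_le]
  rintro _ ⟨x, rfl⟩
  let φ : G → k := fun g => if OddConjClasses.mk (g ^ 2 ^ N) (hN g).1 = x then 1 else 0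
  have hφconj : ∀ {g h : G}, IsConj g h → φ g = φ h := by
    intro g h hgh
    have : OddConjClasses.mk (g ^ 2 ^ N) (hN g).1 = OddConjClasses.mk (h ^ 2 ^ N) (hN h).1 := by
      rw [OddConjClasses.mk_eq_mk_iff]
      obtain ⟨c, rfl⟩ := isConj_iff.1 hgh
      exact isConj_iff.2 ⟨c, (conj_pow).symm⟩
    simp only [φ, this]
  have hφ : ∀ g h, φ (g * h) = φ (h * g) := fun g h =>
    hφconj (isConj_iff.2 ⟨h, by group⟩)
  have hφ2 : ∀ g, φ g ^ 2 = φ g := by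
    intro g
    simp only [φ]
    split_ifs <;> simp
  have hφN : ∀ g, φ (g ^ 2 ^ N) = φ g := by
    intro g
    simp only [φ, (hN _).2 (hN g).1]
  obtain ⟨c, hc⟩ := exists_eq_sum_moduleCharacter (M := (M : Irrep k G → Type u)) (end_scalar hk)
    isEmpty_equiv (groupAlgebraFunctional φ) (groupAlgebraFunctional_mul_comm φ hφ)
    (fun a ha => groupAlgebraFunctional_eq_zero_of_isNilpotent hN0 φ hφ hφ2 hφN
      (isNilpotent_of_forall_smul_eq_zero a ha))
  have hx : Pi.basisFun k (OddConjClasses G) x = ∑ i : Irrep k G, c i • i.charOnOdd := by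
    ext y
    have h := LinearMap.congr_fun hc (MonoidAlgebra.single y.rep 1)
    simp only [LinearMap.sum_apply, LinearMap.smul_apply, moduleCharacter_single,
      groupAlgebraFunctional_single] at h
    have hy : OddConjClasses.mk (y.rep ^ 2 ^ N) (hN y.rep).1 = y := by
      conv_rhs => rw [← y.mk_rep]
      rw [OddConjClasses.mk_eq_mk_iff, (hN y.rep).2 y.odd_orderOf_rep]
    simp only [φ, hy] at h
    rw [Finset.sum_apply, Pi.basisFun_apply, Pi.single_apply, h]
    rfl
  rw [hx]
  exact Submodule.sum_mem _ fun i _ => Submodule.smul_mem _ _ (Submodule.subset_span ⟨i, rfl⟩)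

theorem card_dual_fixed [CharP k 2] (hk : IsSplittingFieldFor k G) :
    Nat.card {i : Irrep k G // i.dual = i} =
      Nat.card {c : OddConjClasses G // c.inv = c} := by
  have := finite hk
  have := Fintype.ofFinite (Irrep k G)
  have := Fintype.ofFinite (OddConjClasses G)
  refine card_fixedPoints_eq_of_basis
    (Basis.mk (linearIndependent_charOnOdd hk) (top_le_span_charOnOdd hk)) dual
    (dual_involutive hk) OddConjClasses.inv OddConjClasses.inv_involutive fun i c => ?_
  rw [Basis.mk_apply, Basis.mk_apply, charOnOdd, charOnOdd, char_dual]
  exact (i.char_eq_of_isConj c.isConj_rep_inv).symm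

end Irrep

theorem numSelfDualIrreps_eq_card_dual_fixed (k : Type u) (G : Type) [Field k] [Group G] [Finite G]
    (hk : IsSplittingFieldFor k G) :
    numSelfDualIrreps k G = Nat.card {i : Irrep k G // i.dual = i} := by
  have hiff : ∀ (M : Rep.{u} k G) (hM : M.ρ.IsIrreducible),
      (Irrep.mk M.ρ hM).dual = Irrep.mk M.ρ hM ↔ IsSelfDualRep M := by
    intro M hM
    have := hM.finiteDimensional
    rw [Irrep.dual_mk hk, eq_comm, Irrep.mk_eq_mk_iff]
    rfl
  refine Nat.card_congr (Equiv.ofBijective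
    (Quotient.lift (fun M => ⟨Irrep.mk M.1.ρ M.2.1, (hiff M.1 M.2.1).2 M.2.2⟩) ?_) ⟨?_, ?_⟩)
  · intro M N h
    exact Subtype.ext (Irrep.mk_eq_mk_iff.2 h)
  · intro x y
    induction x using Quotient.inductionOn with | h M => ?_
    induction y using Quotient.inductionOn with | h N => ?_
    intro h
    exact Quotient.sound (Irrep.mk_eq_mk_iff.1 (Subtype.ext_iff.1 h))
  · rintro ⟨i, hi⟩
    rw [← i.mk_rep, hiff] at hi
    exact ⟨Quotient.mk _ ⟨i.rep, i.isIrreducible_rep, hi⟩, Subtype.ext i.mk_rep⟩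

/-- Over a splitting field of characteristic two, there are as many self-dual irreducible modules
as real classes of elements of odd order. -/
theorem numSelfDualIrreps_eq_card_real_classes (k : Type u) (G : Type) [Field k] [CharP k 2]
    [Group G] [Finite G] (hk : IsSplittingFieldFor k G) :
    numSelfDualIrreps k G = Nat.card {c : OddConjClasses G // c.inv = c} :=
  (numSelfDualIrreps_eq_card_dual_fixed k G hk).trans (Irrep.card_dual_fixed hk)

end SelfDual

/-! ### Permutations of odd order: inverting involutions and centralizers. -/

namespace Equiv.Perm

variable {α : Type*}

/-- A permutation of odd order is inverted by an involution fixing one point in every cycle. -/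
theorem exists_involutive_inverting (g : Perm α) (hg : Odd (orderOf g)) :
    ∃ (h : Perm α) (r : α → α), h ^ 2 = 1 ∧ h * g * h⁻¹ = g⁻¹ ∧ (∀ x, h x = x ↔ r x = x) ∧
      (∀ x, g.SameCycle (r x) x) ∧ ∀ x y, g.SameCycle x y → r x = r y := by
  let r : α → α := fun x => (Quotient.mk (SameCycle.setoid g) x).out
  have hr : ∀ x, g.SameCycle (r x) x := fun x => Quotient.mk_out (s := SameCycle.setoid g) x
  have hr' : ∀ x y, g.SameCycle x y → r x = r y := fun x y h =>
    congrArg Quotient.out (Quotient.sound (s := SameCycle.setoid g) h)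
  have hex : ∀ x, ∃ i : ℤ, (g ^ i) (r x) = x := hr
  choose i hi using hex
  -- The exponent `i x` is determined only modulo the cycle length; this makes its negation well
  -- defined on points.
  have hswap : ∀ (a b : ℤ) z, (g ^ a) z = (g ^ b) z → (g ^ (-a)) z = (g ^ (-b)) z := by
    intro a b z h
    have h1 : (g ^ (-a - b)) ((g ^ b) z) = (g ^ (-a)) z := by
      rw [← mul_apply, ← zpow_add]; congr 2; ring
    have h2 : (g ^ (-a - b)) ((g ^ a) z) = (g ^ (-b)) z := by
      rw [← mul_apply, ← zpow_add]; congr 2; ring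
    rw [← h1, ← h, h2]
  -- The reflection of each cycle about its base point.
  let f : α → α := fun x => (g ^ (-i x)) (r x)
  have hf : ∀ x (j : ℤ), f ((g ^ j) (r x)) = (g ^ (-j)) (r x) := by
    intro x j
    have hry : r ((g ^ j) (r x)) = r x :=
      hr' _ _ ((sameCycle_zpow_left.2 (hr x)))
    have := hi ((g ^ j) (r x))
    simp only [f]
    rw [hry] at this ⊢
    exact hswap _ _ _ this
  have hfx : ∀ x, f x = (g ^ (-i x)) (r x) := fun _ => rfl
  have hinv : Function.Involutive f := by
    intro x
    rw [hfx x, hf, neg_neg, hi]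
  refine ⟨hinv.toPerm f, r, ?_, ?_, ?_, hr, hr'⟩
  · ext x
    exact hinv x
  · rw [mul_inv_eq_iff_eq_mul]
    ext x
    change f (g x) = g⁻¹ (f x)
    have h1 : g x = (g ^ (1 + i x)) (r x) := by rw [zpow_add, mul_apply, hi, zpow_one]
    rw [h1, hf, hfx, ← mul_apply, ← zpow_neg_one, ← zpow_add]
    congr 2
    ring
  · intro x
    change f x = x ↔ r x = x
    constructor
    · intro hx
      have h1 : (g ^ (-i x)) (r x) = (g ^ i x) (r x) := hx.trans (hi x).symm
      obtain ⟨m, hm⟩ := hg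
      -- A fixed point `g ^ i (r x)` has `g ^ (2i)` fixing `r x`; since `g` has odd order, so does
      -- `g ^ i`, and the point is `r x` itself.
      have h2 : ((g ^ i x) ^ 2) (r x) = r x := by
        rw [sq, mul_apply, ← h1, ← mul_apply, ← zpow_add, add_neg_cancel, zpow_zero, one_apply]
      have h3 : ((g ^ i x) ^ (2 * m + 1)) (r x) = r x := by
        rw [← hm, ← zpow_natCast, ← zpow_mul, mul_comm, zpow_mul, zpow_natCast, pow_orderOf_eq_one,
          one_zpow, one_apply]
      rw [pow_succ', pow_mul, mul_apply] at h3
      rw [pow_apply_eq_self_of_apply_eq_self h2, hi] at h3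
      exact h3.symm
    · intro hx
      have := hf x 0
      simpa [hx] using this

variable [Fintype α] [DecidableEq α]

/-- The map `r` fixes exactly one point of each cycle: points in the support count the nontrivial
cycles, the others the parts equal to 1. -/
theorem card_cycles_eq_card_parts_partition (g : Perm α) (r : α → α)
    (hr : ∀ x, g.SameCycle (r x) x) (hr' : ∀ x y, g.SameCycle x y → r x = r y) :
    (Finset.univ.filter fun x => r x = x).card = g.partition.parts.card := by
  classical
  rw [parts_partition, Multiset.card_add, Multiset.card_replicate, cycleType_def, Multiset.card_map,
    ← Finset.card_filter_add_card_filter_not (p := fun x => x ∈ g.support)]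
  congr 1
  · refine Finset.card_bij (fun x _ => g.cycleOf x) ?_ ?_ ?_
    · intro x hx
      exact cycleOf_mem_cycleFactorsFinset_iff.2 (Finset.mem_filter.1 hx).2
    · intro x hx y hy hxy
      simp only [Finset.mem_filter, Finset.mem_univ, true_and] at hx hy
      rw [← hx.1, ← hy.1]
      exact hr' _ _ ((sameCycle_iff_cycleOf_eq_of_mem_support hx.2 hy.2).2 hxy)
    · intro c hc
      obtain ⟨x, hx⟩ := (mem_cycleFactorsFinset_iff.1 hc).1.nonempty_support
      have hcx := cycle_is_cycleOf hx hc
      refine ⟨r x, ?_, ?_⟩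
      · simp only [Finset.mem_filter, Finset.mem_univ, true_and]
        refine ⟨hr' _ _ (hr x), ((hr x).mem_support_iff).2 ?_⟩
        exact cycleOf_mem_cycleFactorsFinset_iff.1 (hcx ▸ hc)
      · rw [hcx, (hr x).cycleOf_eq]
  · rw [← Finset.card_compl]
    congr 1
    ext x
    simp only [Finset.mem_filter, Finset.mem_univ, true_and, Finset.mem_compl,
      and_iff_right_iff_imp]
    intro hx
    rw [notMem_support] at hx
    obtain ⟨i, hi⟩ := (hr x).symm
    rw [zpow_apply_eq_self_of_apply_eq_self hx] at hi
    exact hi.symm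

theorem exists_inverting_sign_eq (g : Perm α) (hg : Odd (orderOf g)) :
    ∃ h : Perm α, h * g * h⁻¹ = g⁻¹ ∧
      sign h = (-1) ^ ((Fintype.card α - g.partition.parts.card) / 2) := by
  obtain ⟨h, r, h2, hinv, hfix, hr, hr'⟩ := exists_involutive_inverting g hg
  refine ⟨h, hinv, ?_⟩
  rw [sign_of_pow_two_eq_one h2, ← card_cycles_eq_card_parts_partition g r hr hr']
  congr 3
  rw [Fintype.card_subtype]
  congr 1
  ext x
  simp only [Finset.mem_filter, Finset.mem_univ, true_and, Function.mem_fixedPoints,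
    Function.IsFixedPt, hfix]

theorem odd_orderOf_iff_forall_mem_cycleType (g : Perm α) :
    Odd (orderOf g) ↔ ∀ m ∈ g.cycleType, Odd m := by
  refine ⟨fun h m hm => h.of_dvd_nat (dvd_of_mem_cycleType hm), fun h => ?_⟩
  have hprod : Odd g.cycleType.prod :=
    Multiset.prod_induction Odd _ (fun _ _ ha hb => ha.mul hb) odd_one h
  refine hprod.of_dvd_nat ?_
  rw [← lcm_cycleType]
  exact Multiset.lcm_dvd.2 fun m hm => Multiset.dvd_prod hm

theorem partition_mem_odds_iff (g : Perm α) :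
    g.partition ∈ Nat.Partition.odds (Fintype.card α) ↔ Odd (orderOf g) := by
  rw [odd_orderOf_iff_forall_mem_cycleType, Nat.Partition.odds, Nat.Partition.restricted,
    Finset.mem_filter, parts_partition]
  simp only [Finset.mem_univ, true_and, Multiset.mem_add, Nat.not_even_iff_odd]
  refine ⟨fun h m hm => h m (Or.inl hm), fun h m hm => hm.elim (h m) fun hm => ?_⟩
  rw [Multiset.eq_of_mem_replicate hm]
  exact odd_one

theorem exists_partition_eq (μ : (Fintype.card α).Partition) : ∃ g : Perm α, g.partition = μ := by
  have hsplit := Multiset.filter_add_not (fun m => 2 ≤ m) μ.parts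
  have hones : μ.parts.filter (fun m => ¬ 2 ≤ m) =
      Multiset.replicate (μ.parts.filter (fun m => ¬ 2 ≤ m)).card 1 := by
    refine Multiset.eq_replicate_card.2 fun m hm => ?_
    have h1 := Multiset.mem_filter.1 hm
    have := μ.parts_pos h1.1
    omega
  have hsum : (μ.parts.filter fun m => 2 ≤ m).sum +
      (μ.parts.filter (fun m => ¬ 2 ≤ m)).card = Fintype.card α := by
    have := congrArg Multiset.sum hsplit
    rw [Multiset.sum_add, hones, Multiset.sum_replicate, μ.parts_sum] at this
    simpa using this
  obtain ⟨g, hg⟩ := (exists_with_cycleType_iff α (m := μ.parts.filter fun m => 2 ≤ m)).2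
    ⟨by omega, fun m hm => (Multiset.mem_filter.1 hm).2⟩
  refine ⟨g, Nat.Partition.ext ?_⟩
  rw [parts_partition, ← sum_cycleType, hg]
  conv_rhs => rw [← hsplit, hones]
  congr 2
  omega

/-- For odd cycle lengths, the centralizer is even exactly when no length repeats and there is at
most one fixed point. As `partition` records fixed points as parts 1, both conditions together say
that it is strict. -/
theorem centralizer_le_alternatingGroup_iff_nodup (g : Perm α) (hg : Odd (orderOf g)) :
    Subgroup.centralizer {g} ≤ alternatingGroup α ↔ g.partition.parts.Nodup := by
  rw [centralizer_le_alternating_iff, and_iff_right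
    ((odd_orderOf_iff_forall_mem_cycleType g).1 hg), Multiset.nodup_iff_count_le_one,
    parts_partition, ← sum_cycleType]
  have h1 : Multiset.count 1 g.cycleType = 0 :=
    Multiset.count_eq_zero.2 fun h => by simpa using two_le_of_mem_cycleType h
  simp only [Multiset.count_add, Multiset.count_replicate]
  constructor
  · rintro ⟨hc, hi⟩ a
    by_cases ha : a = 1
    · subst ha
      rw [h1, if_pos rfl]
      omega
    · rw [if_neg fun h => ha h.symm, add_zero]
      exact hi a
  · intro h
    refine ⟨?_, fun i => le_trans (Nat.le_add_right _ _) (h i)⟩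
    have := h 1
    rw [if_pos rfl] at this
    omega

theorem sign_eq_one_of_odd_orderOf {g : Perm α} (hg : Odd (orderOf g)) : sign g = 1 := by
  have h : sign g ^ orderOf g = 1 := by rw [← map_pow, pow_orderOf_eq_one, map_one]
  rcases Int.units_eq_one_or (sign g) with h1 | h1
  · exact h1
  · rw [h1, hg.neg_one_pow] at h
    exact absurd h (by decide)

end Equiv.Perm

/-! ### Real classes of odd order in the alternating group. -/

namespace alternatingGroup

open Equiv Equiv.Perm

variable {α : Type*} [Fintype α] [DecidableEq α]

/-- An odd conjugating permutation becomes even after multiplication by an odd element of the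
centralizer. -/
theorem isConj_of_isConj_coe {g h : alternatingGroup α} (hgh : IsConj (g : Perm α) (h : Perm α))
    (hcent : ¬ Subgroup.centralizer {(g : Perm α)} ≤ alternatingGroup α) : IsConj g h := by
  obtain ⟨c, hc⟩ := isConj_iff.1 hgh
  by_cases hcs : sign c = 1
  · exact isConj_iff.2 ⟨⟨c, hcs⟩, Subtype.ext hc⟩
  · rw [SetLike.not_le_iff_exists] at hcent
    obtain ⟨z, hz, hzA⟩ := hcent
    rw [Subgroup.mem_centralizer_singleton_iff] at hz
    have hcs' := (Int.units_eq_one_or (sign c)).resolve_left hcs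
    have hzs := (Int.units_eq_one_or (sign z)).resolve_left hzA
    refine isConj_iff.2 ⟨⟨c * z, ?_⟩, Subtype.ext ?_⟩
    · rw [mem_alternatingGroup, map_mul, hcs', hzs]
      rfl
    · change c * z * g * (c * z)⁻¹ = h
      rw [← hc, mul_inv_rev, mul_assoc c, hz]
      group

/-- Two permutations conjugating `g` to `h` differ by an element of the centralizer, so here they
all have the same sign and one of them decides. -/
theorem isConj_iff_mem_of_centralizer_le {g h : alternatingGroup α} {c : Perm α}
    (hc : c * g * c⁻¹ = h)
    (hcent : Subgroup.centralizer {(g : Perm α)} ≤ alternatingGroup α) :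
    IsConj g h ↔ c ∈ alternatingGroup α := by
  refine ⟨fun hgh => ?_, fun hcA => isConj_iff.2 ⟨⟨c, hcA⟩, Subtype.ext hc⟩⟩
  obtain ⟨d, hd⟩ := isConj_iff.1 hgh
  have hd' : (d : Perm α) * g * (d : Perm α)⁻¹ = h := congrArg Subtype.val hd
  have hz : (d : Perm α)⁻¹ * c ∈ Subgroup.centralizer {(g : Perm α)} := by
    rw [Subgroup.mem_centralizer_singleton_iff]
    have : c * g * c⁻¹ = (d : Perm α) * g * (d : Perm α)⁻¹ := hc.trans hd'.symm
    rw [mul_inv_eq_iff_eq_mul] at this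
    rw [mul_assoc, this]
    group
  have := mul_mem d.2 (hcent hz)
  rwa [mul_inv_cancel_left] at this

theorem isConj_inv_iff (g : alternatingGroup α) (hg : Odd (orderOf (g : Perm α))) :
    IsConj g g⁻¹ ↔ (g : Perm α).partition.parts.Nodup →
      Even ((Fintype.card α - (g : Perm α).partition.parts.card) / 2) := by
  by_cases hnd : (g : Perm α).partition.parts.Nodup
  · obtain ⟨h, hinv, hsign⟩ := exists_inverting_sign_eq (g : Perm α) hg
    rw [isConj_iff_mem_of_centralizer_le (h := g⁻¹) hinv
      ((centralizer_le_alternatingGroup_iff_nodup _ hg).2 hnd), mem_alternatingGroup, hsign]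
    simp only [hnd, true_imp_iff]
    exact neg_one_pow_eq_one_iff_even (by decide)
  · simp only [hnd, false_imp_iff, iff_true]
    refine isConj_of_isConj_coe ?_ ((centralizer_le_alternatingGroup_iff_nodup _ hg).not.2 hnd)
    exact isConj_of_cycleType_eq (cycleType_inv _).symm

/-- The cycle type of a class of elements of odd order. -/
noncomputable def classPartition (c : OddConjClasses (alternatingGroup α)) :
    (Fintype.card α).Partition := (c.rep : Perm α).partition

theorem odd_orderOf_coe_rep (c : OddConjClasses (alternatingGroup α)) :
    Odd (orderOf (c.rep : Perm α)) := by
  rw [Subgroup.orderOf_coe]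
  exact c.odd_orderOf_rep

theorem inv_eq_self_iff (c : OddConjClasses (alternatingGroup α)) :
    c.inv = c ↔ ((classPartition c).parts.Nodup →
      Even ((Fintype.card α - (classPartition c).parts.card) / 2)) :=
  c.inv_eq_self_iff.trans (isConj_inv_iff _ (odd_orderOf_coe_rep c))

theorem classPartition_mem_odds (c : OddConjClasses (alternatingGroup α)) :
    classPartition c ∈ Nat.Partition.odds (Fintype.card α) :=
  (partition_mem_odds_iff _).2 (odd_orderOf_coe_rep c)

theorem classPartition_mk (g : alternatingGroup α) (hg : Odd (orderOf g)) :
    classPartition (OddConjClasses.mk g hg) = (g : Perm α).partition := by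
  refine partition_eq_of_isConj.1 ?_
  obtain ⟨d, hd⟩ := isConj_iff.1 (OddConjClasses.isConj_rep_mk g hg)
  exact isConj_iff.2 ⟨d, congrArg Subtype.val hd⟩

theorem exists_classPartition_eq {μ : (Fintype.card α).Partition}
    (hμ : μ ∈ Nat.Partition.odds (Fintype.card α)) :
    ∃ c : OddConjClasses (alternatingGroup α), classPartition c = μ := by
  obtain ⟨g, rfl⟩ := exists_partition_eq μ
  have hg := (partition_mem_odds_iff g).1 hμ
  refine ⟨OddConjClasses.mk ⟨g, sign_eq_one_of_odd_orderOf hg⟩ ?_, classPartition_mk _ _⟩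
  rw [← Subgroup.orderOf_coe]
  exact hg

theorem card_classPartition_fiber_of_not_nodup {μ : (Fintype.card α).Partition}
    (hμ : μ ∈ Nat.Partition.odds (Fintype.card α)) (hnd : ¬ μ.parts.Nodup) :
    Nat.card {c : OddConjClasses (alternatingGroup α) // classPartition c = μ} = 1 := by
  obtain ⟨c₀, hc₀⟩ := exists_classPartition_eq hμ
  refine Nat.card_eq_one_iff_unique.2 ⟨⟨?_⟩, ⟨⟨c₀, hc₀⟩⟩⟩
  rintro ⟨c, rfl⟩ ⟨d, hd⟩
  refine Subtype.ext ?_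
  change c = d
  rw [← c.mk_rep, ← d.mk_rep, OddConjClasses.mk_eq_mk_iff]
  refine isConj_of_isConj_coe (partition_eq_of_isConj.2 hd.symm) ?_
  exact (centralizer_le_alternatingGroup_iff_nodup _ (odd_orderOf_coe_rep c)).not.2 hnd

/-- Conjugation by a transposition, available since `α` is nontrivial, leads to the second class.
Any permutation conjugating `c.rep` to another element of this cycle type is even, or becomes even
after division by that transposition. -/
theorem card_classPartition_fiber_of_nodup [Nontrivial α] {μ : (Fintype.card α).Partition}
    (hμ : μ ∈ Nat.Partition.odds (Fintype.card α)) (hnd : μ.parts.Nodup) :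
    Nat.card {c : OddConjClasses (alternatingGroup α) // classPartition c = μ} = 2 := by
  obtain ⟨c, rfl⟩ := exists_classPartition_eq hμ
  obtain ⟨x, y, hxy⟩ := exists_pair_ne α
  have hs : sign (swap x y) = -1 := sign_swap hxy
  have hcent := (centralizer_le_alternatingGroup_iff_nodup _ (odd_orderOf_coe_rep c)).2 hnd
  have hord : orderOf (swap x y * (c.rep : Perm α) * (swap x y)⁻¹) = orderOf (c.rep : Perm α) :=
    (isConj_iff.2 ⟨_, rfl⟩ : IsConj (c.rep : Perm α) _).orderOf_eq.symm
  have hodd : Odd (orderOf (swap x y * (c.rep : Perm α) * (swap x y)⁻¹)) :=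
    hord ▸ odd_orderOf_coe_rep c
  let g : alternatingGroup α := ⟨_, sign_eq_one_of_odd_orderOf hodd⟩
  have hg : Odd (orderOf g) := by rw [← Subgroup.orderOf_coe]; exact hodd
  have hgc : swap x y * (c.rep : Perm α) * (swap x y)⁻¹ = g := rfl
  have hgp : classPartition (OddConjClasses.mk g hg) = classPartition c := by
    rw [classPartition_mk]
    exact (partition_eq_of_isConj.1 (isConj_iff.2 ⟨_, hgc⟩)).symm
  refine Nat.card_eq_two_iff.2 ⟨⟨c, rfl⟩, ⟨OddConjClasses.mk g hg, hgp⟩, fun h => ?_, ?_⟩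
  · have h1 : c = OddConjClasses.mk g hg := congrArg Subtype.val h
    conv_lhs at h1 => rw [← c.mk_rep]
    rw [OddConjClasses.mk_eq_mk_iff, isConj_iff_mem_of_centralizer_le hgc hcent,
      mem_alternatingGroup, hs] at h1
    exact absurd h1 (by decide)
  · rw [Set.eq_univ_iff_forall]
    rintro ⟨d, hd⟩
    obtain ⟨t, ht⟩ := isConj_iff.1 (partition_eq_of_isConj.2 hd.symm)
    rcases Int.units_eq_one_or (sign t) with hts | hts
    · left
      refine Subtype.ext ?_
      change d = c
      rw [← c.mk_rep, ← d.mk_rep, OddConjClasses.mk_eq_mk_iff, isConj_comm,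
        isConj_iff_mem_of_centralizer_le ht hcent]
      exact hts
    · right
      refine Subtype.ext ?_
      change d = OddConjClasses.mk g hg
      rw [← d.mk_rep, OddConjClasses.mk_eq_mk_iff, isConj_comm]
      refine isConj_iff.2 ⟨⟨t * (swap x y)⁻¹, ?_⟩, Subtype.ext ?_⟩
      · rw [mem_alternatingGroup, map_mul, map_inv, hs, hts]
        rfl
      · change t * (swap x y)⁻¹ * (swap x y * (c.rep : Perm α) * (swap x y)⁻¹) *
          (t * (swap x y)⁻¹)⁻¹ = _
        rw [← ht]
        group

theorem card_real_classPartition_fiber [Nontrivial α] (μ : (Fintype.card α).Partition) :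
    Nat.card {c : {c : OddConjClasses (alternatingGroup α) // c.inv = c} //
        classPartition c.1 = μ} =
      (if μ ∈ nonStrictOddPartitions (Fintype.card α) then 1 else 0) +
        2 * (if μ ∈ strictOddPartitionsEven (Fintype.card α) then 1 else 0) := by
  have hreal : (μ.parts.Nodup → Even ((Fintype.card α - μ.parts.card) / 2)) →
      Nat.card {c : {c : OddConjClasses (alternatingGroup α) // c.inv = c} //
        classPartition c.1 = μ} =
      Nat.card {c : OddConjClasses (alternatingGroup α) // classPartition c = μ} := by
    intro h
    exact Nat.card_congr (Equiv.subtypeSubtypeEquivSubtype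
      (q := fun c => classPartition c = μ) fun {c} hc => (inv_eq_self_iff c).2 (by rwa [hc]))
  simp only [nonStrictOddPartitions, strictOddPartitionsEven, Nat.Partition.oddDistincts,
    Finset.mem_sdiff, Finset.mem_filter, Finset.mem_inter, Nat.Partition.distincts,
    Finset.mem_univ, true_and]
  by_cases hμ : μ ∈ Nat.Partition.odds (Fintype.card α)
  · by_cases hnd : μ.parts.Nodup
    · by_cases he : Even ((Fintype.card α - μ.parts.card) / 2)
      · rw [hreal fun _ => he, card_classPartition_fiber_of_nodup hμ hnd]
        simp [hμ, hnd, he]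
      -- A strict type with odd `(n - ℓ) / 2`: neither half of the split class is real.
      · have : IsEmpty {c : {c : OddConjClasses (alternatingGroup α) // c.inv = c} //
            classPartition c.1 = μ} :=
          ⟨fun ⟨⟨c, hc⟩, hcμ⟩ => he (hcμ ▸ (inv_eq_self_iff c).1 hc (hcμ ▸ hnd))⟩
        rw [Nat.card_of_isEmpty]
        simp [hnd, he]
    · rw [hreal fun h => absurd h hnd, card_classPartition_fiber_of_not_nodup hμ hnd]
      simp [hμ, hnd]
  · have : IsEmpty {c : {c : OddConjClasses (alternatingGroup α) // c.inv = c} //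
        classPartition c.1 = μ} :=
      ⟨fun ⟨⟨c, _⟩, hcμ⟩ => hμ (hcμ ▸ classPartition_mem_odds c)⟩
    rw [Nat.card_of_isEmpty]
    simp [hμ]

/-- The number of real classes of elements of odd order in an alternating group. -/
theorem card_real_oddConjClasses [Nontrivial α] :
    Nat.card {c : OddConjClasses (alternatingGroup α) // c.inv = c} =
      (nonStrictOddPartitions (Fintype.card α)).card +
        2 * (strictOddPartitionsEven (Fintype.card α)).card := by
  rw [← Nat.card_congr (Equiv.sigmaFiberEquiv
    fun c : {c : OddConjClasses (alternatingGroup α) // c.inv = c} => classPartition c.1),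
    Nat.card_sigma]
  simp only [card_real_classPartition_fiber, Finset.sum_add_distrib, ← Finset.mul_sum,
    Finset.sum_boole, Nat.cast_id, Finset.filter_univ_mem]

end alternatingGroup

theorem lemma2p1 (k : Type u) [Field k] [CharP k 2] (n : ℕ) (hn : 2 ≤ n)
    (hk : IsSplittingFieldFor k (alternatingGroup (Fin n))) :
    numSelfDualIrreps k (alternatingGroup (Fin n)) =
      (nonStrictOddPartitions n).card + 2 * (strictOddPartitionsEven n).card := by
  have : Nontrivial (Fin n) := Fin.nontrivial_iff_two_le.2 hn
  rw [numSelfDualIrreps_eq_card_real_classes k _ hk, alternatingGroup.card_real_oddConjClasses,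
    Fintype.card_fin]
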